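/- Let $Z$ be a separable real or complex Banach space and let $T$ be a bounded linear operator on $Z$ which is weakly compact, i.e. the image under $T$ of the closed unit ball of $Z$ has weakly compact closure in the weak topology of $Z$. A bounded operator on a Banach space $E$ is said to have no non-trivial invariant closed subspace (respectively, subset) if no closed linear subspace (respectively, no non-empty closed subset) of $E$ other than $\{0\}$ and $E$ is mapped into itself by the operator. Suppose that $T$ has no non-trivial invariant closed subspace (respectively, subset). Then there exist a separable reflexive Banach space $X$ over the same scalar field, infinite-dimensional whenever $Z$ is, and bounded linear operators $A : Z \to X$ and $B : X \to Z$ such that $T = BA$, $A$ has dense range, $B$ is injective, and the operator $T_0 = AB$ on $X$ has no non-trivial invariant closed subspace (respectively, subset). -/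

import Mathlib

universe u v

/-- A normed space is reflexive when the canonical embedding into its bidual is onto. -/
def IsReflexiveSpace (𝕜 E : Type*) [RCLike 𝕜] [NormedAddCommGroup E] [NormedSpace 𝕜 E] : Prop :=
  Function.Surjective (NormedSpace.inclusionInDoubleDual 𝕜 E)

/-- A bounded operator is weakly compact when it sends the closed unit ball to a set whose closure
in the weak topology is weakly compact. -/
def IsWeaklyCompactOperator {𝕜 E F : Type*} [RCLike 𝕜] [NormedAddCommGroup E] [NormedSpace 𝕜 E]
    [NormedAddCommGroup F] [NormedSpace 𝕜 F] (T : E →L[𝕜] F) : Prop :=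
  IsCompact (closure ((fun x => toWeakSpace 𝕜 F (T x)) '' Metric.closedBall (0 : E) 1))

/-- `T` has an invariant closed subspace other than `{0}` and the whole space. -/
def HasNontrivialInvariantClosedSubspace {𝕜 E : Type*} [RCLike 𝕜] [NormedAddCommGroup E]
    [NormedSpace 𝕜 E] (T : E →L[𝕜] E) : Prop :=
  ∃ M : Submodule 𝕜 E, IsClosed (M : Set E) ∧ M ≠ ⊥ ∧ M ≠ ⊤ ∧ ∀ x ∈ M, T x ∈ M

/-- `T` has a nonempty invariant closed subset other than `{0}` and the whole space. -/
def HasNontrivialInvariantClosedSubset {𝕜 E : Type*} [RCLike 𝕜] [NormedAddCommGroup E]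
    [NormedSpace 𝕜 E] (T : E →L[𝕜] E) : Prop :=
  ∃ F : Set E, IsClosed F ∧ F.Nonempty ∧ F ≠ {0} ∧ F ≠ Set.univ ∧ ∀ x ∈ F, T x ∈ F

/-! The proof is the Davis–Figiel–Johnson–Pełczyński factorization of a weakly compact operator through
a reflexive space, arranged so that the first factor has dense range.

For each `n` the space `Z` is renormed by the gauge of `2 ^ n T (ball) + 2⁻¹ ^ n ball`; the operator
`T` has norm at most `2⁻¹ ^ n` into this renorming (`DFJP.norm_stageFactor_le`), so that `z` can be sent
to the constant sequence `T z` in the `ℓ²` sum of the renormings. The intermediate space `X` is the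
closure of the range of this map `A`, and `B : X → Z` takes a constant sequence to its value.

Reflexivity (`DFJP.isReflexiveSpace_space`): let `φ` be in the bidual of `X`. For every `n`, the
functional `B** φ` on `Z*` is bounded by a multiple of `2 ^ n ‖T* g‖ + 2⁻¹ ^ n ‖g‖`, so it is within
a multiple of `2⁻¹ ^ n` of an element of the range of `T**`, which lies in `Z` because `T` is weakly
compact (`IsWeaklyCompactOperator.exists_bidual_eq`). Hence `B** φ` is a point `w` of `Z`. Functionals
on an `ℓ²` sum are norm limits of functionals depending on finitely many coordinates, and this shows
that the constant sequence `w` belongs to `X` and represents `φ` (`lp.exists_forall_apply_eq`).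

Finally, if `M` is closed and invariant under `A B`, then the closure of `B M` is invariant under
`B A = T`, is non-trivial since `B` is injective, and is proper since `A` maps it into `M` and has
dense range. If `X` were finite-dimensional and `Z` were not, the kernel of `A`, or a line if `A = 0`,
would be a non-trivial invariant subspace of `T`. -/

/-! ### Weakly compact operators and the bidual -/

section

open Filter Topology

variable {𝕜 Z : Type*} [RCLike 𝕜] [NormedAddCommGroup Z] [NormedSpace 𝕜 Z]

/-- Hahn–Banach separation in a weak topology `σ(E, F)`: the separating functional is the pairing with
an element of `F`. Convexity is stated through scalars of `𝕜`, so that no real module structure on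
`E` has to be chosen. -/
theorem WeakBilin.exists_re_lt_of_notMem {E F : Type*} [AddCommGroup E] [Module 𝕜 E]
    [AddCommGroup F] [Module 𝕜 F] (B : E →ₗ[𝕜] F →ₗ[𝕜] 𝕜) {K : Set (WeakBilin B)}
    (hK : IsClosed K)
    (hconv : ∀ x ∈ K, ∀ y ∈ K, ∀ a b : ℝ, 0 ≤ a → 0 ≤ b → a + b = 1 →
      (a : 𝕜) • x + (b : 𝕜) • y ∈ K)
    {x : WeakBilin B} (hx : x ∉ K) :
    ∃ (y : F) (u : ℝ), (∀ k ∈ K, RCLike.re (B k y) < u) ∧ u < RCLike.re (B x y) := by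
  let _ : Module ℝ E := Module.compHom E (algebraMap ℝ 𝕜)
  have : IsScalarTower ℝ 𝕜 E := IsScalarTower.of_algebraMap_smul fun _ _ => rfl
  let _ : Module ℝ (WeakBilin B) := inferInstanceAs (Module ℝ E)
  have : IsScalarTower ℝ 𝕜 (WeakBilin B) := inferInstanceAs (IsScalarTower ℝ 𝕜 E)
  have : LocallyConvexSpace ℝ (WeakBilin B) := WeakBilin.locallyConvexSpace
  have hK' : Convex ℝ K := fun x hx y hy a b ha hb hab => hconv x hx y hy a b ha hb hab
  obtain ⟨f, u, hf, hu⟩ := RCLike.geometric_hahn_banach_closed_point (𝕜 := 𝕜) hK' hK hx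
  obtain ⟨g, rfl⟩ := LinearMap.dualEmbedding_surjective B f
  exact ⟨g, u, hf, hu⟩

theorem WeakSpace.smul_add_smul_mem_closure {V : Set Z} (hV : ∀ x ∈ V, ∀ y ∈ V, ∀ a b : ℝ,
    0 ≤ a → 0 ≤ b → a + b = 1 → (a : 𝕜) • x + (b : 𝕜) • y ∈ V) {x y : WeakSpace 𝕜 Z}
    (hx : x ∈ closure (toWeakSpace 𝕜 Z '' V)) (hy : y ∈ closure (toWeakSpace 𝕜 Z '' V))
    {a b : ℝ} (ha : 0 ≤ a) (hb : 0 ≤ b) (hab : a + b = 1) :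
    (a : 𝕜) • x + (b : 𝕜) • y ∈ closure (toWeakSpace 𝕜 Z '' V) := by
  refine map_mem_closure₂ (f := fun x y : WeakSpace 𝕜 Z => (a : 𝕜) • x + (b : 𝕜) • y)
    (by fun_prop) hx hy ?_
  rintro _ ⟨x, hx, rfl⟩ _ ⟨y, hy, rfl⟩
  exact ⟨_, hV x hx y hy a b ha hb hab, by simp⟩

theorem norm_le_of_forall_re_le {f : StrongDual 𝕜 Z} {u : ℝ}
    (h : ∀ z, ‖z‖ ≤ 1 → RCLike.re (f z) ≤ u) : ‖f‖ ≤ u := by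
  have hu0 : 0 ≤ u := by simpa using h 0 (by simp)
  refine f.opNorm_le_of_unit_norm hu0 fun z hz => ?_
  obtain ⟨c, hc, hcz⟩ := RCLike.exists_norm_eq_mul_self (f z)
  have := h (c • z) (by simp [norm_smul, hc, hz])
  rwa [map_smul, smul_eq_mul, ← hcz, RCLike.ofReal_re] at this

/-- The second adjoint of a weakly compact operator maps the unit ball of the bidual into the original
space. The weak closure of the image of the unit ball stays compact, hence closed, in the algebraic
dual of `Z*` with its weak-* topology; a point of `T** (ball Z**)` outside it would be separated from
it by an element of `Z*`. -/
theorem IsWeaklyCompactOperator.exists_bidual_eq_of_norm_le_one {T : Z →L[𝕜] Z}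
    (hT : IsWeaklyCompactOperator T) (φ : StrongDual 𝕜 Z →ₗ[𝕜] 𝕜) (hφ : ∀ g, ‖φ g‖ ≤ ‖g‖) :
    ∃ w : Z, ∀ g : StrongDual 𝕜 Z, φ (g.comp T) = g w := by
  let V : Set Z := T '' Metric.closedBall (0 : Z) 1
  -- The algebraic dual of `Z*` is used instead of the bidual: only its weak-* topology matters.
  let B : (StrongDual 𝕜 Z →ₗ[𝕜] 𝕜) →ₗ[𝕜] StrongDual 𝕜 Z →ₗ[𝕜] 𝕜 := LinearMap.id
  let ι : WeakSpace 𝕜 Z →ₗ[𝕜] WeakBilin B := (topDualPairing 𝕜 Z).flip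
  have hι : Continuous ι :=
    WeakBilin.continuous_of_continuous_eval _ fun g => WeakBilin.eval_continuous _ g
  have hT' : IsCompact (closure (toWeakSpace 𝕜 Z '' V)) := by
    rw [IsWeaklyCompactOperator] at hT
    simpa only [V, Set.image_image] using hT
  have : T2Space (WeakBilin B) :=
    (WeakBilin.isEmbedding (B := B) fun _ _ h => h).t2Space
  let K : Set (WeakBilin B) := ι '' closure (toWeakSpace 𝕜 Z '' V)
  have hKclosed : IsClosed K := (hT'.image hι).isClosed
  let ψ : WeakBilin B := φ.comp (ContinuousLinearMap.precomp 𝕜 T).toLinearMap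
  by_cases h : ψ ∈ K
  · obtain ⟨w, -, hw⟩ := h
    refine ⟨(toWeakSpace 𝕜 Z).symm w, fun g => ?_⟩
    exact (LinearMap.congr_fun hw g).symm
  · exfalso
    obtain ⟨g, u, hg, hu⟩ := WeakBilin.exists_re_lt_of_notMem B hKclosed (by
      rintro _ ⟨x, hx, rfl⟩ _ ⟨y, hy, rfl⟩ a b ha hb hab
      refine ⟨_, WeakSpace.smul_add_smul_mem_closure ?_ hx hy ha hb hab, by simp⟩
      rintro _ ⟨x, hx, rfl⟩ _ ⟨y, hy, rfl⟩ a b ha hb hab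
      refine ⟨(a : 𝕜) • x + (b : 𝕜) • y, ?_, by simp⟩
      rw [mem_closedBall_zero_iff] at hx hy ⊢
      calc ‖(a : 𝕜) • x + (b : 𝕜) • y‖ ≤ a * ‖x‖ + b * ‖y‖ := by
            refine (norm_add_le _ _).trans_eq ?_
            simp [norm_smul, abs_of_nonneg, ha, hb]
        _ ≤ a * 1 + b * 1 := by gcongr
        _ = 1 := by simp [hab]) h
    have hball : ∀ z : Z, ‖z‖ ≤ 1 → RCLike.re ((g.comp T) z) ≤ u := fun z hz =>
      (hg (ι (toWeakSpace 𝕜 Z (T z)))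
        ⟨_, subset_closure ⟨_, ⟨z, by simpa using hz, rfl⟩, rfl⟩, rfl⟩).le
    have hψ : u < RCLike.re (φ (g.comp T)) := hu
    have := (RCLike.re_le_norm (φ (g.comp T))).trans
      ((hφ _).trans (norm_le_of_forall_re_le hball))
    linarith

/-- Gantmacher: the second adjoint of a weakly compact operator takes values in the original space. -/
theorem IsWeaklyCompactOperator.exists_bidual_eq {T : Z →L[𝕜] Z}
    (hT : IsWeaklyCompactOperator T) (φ : StrongDual 𝕜 (StrongDual 𝕜 Z)) :
    ∃ w : Z, ∀ g : StrongDual 𝕜 Z, φ (g.comp T) = g w := by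
  -- Dividing by `‖φ‖ + 1` rather than `‖φ‖` avoids treating `φ = 0` apart.
  have hpos : 0 < ‖φ‖ + 1 := by positivity
  have hne : ((‖φ‖ + 1 : ℝ) : 𝕜) ≠ 0 := by exact_mod_cast hpos.ne'
  obtain ⟨w, hw⟩ := hT.exists_bidual_eq_of_norm_le_one
    (((‖φ‖ + 1 : ℝ) : 𝕜)⁻¹ • φ.toLinearMap) (fun g => by
      have := φ.le_opNorm g
      rw [LinearMap.smul_apply, norm_smul, norm_inv, RCLike.norm_ofReal, abs_of_pos hpos,
        inv_mul_le_iff₀ hpos]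
      refine this.trans ?_
      gcongr
      linarith)
  refine ⟨((‖φ‖ + 1 : ℝ) : 𝕜) • w, fun g => ?_⟩
  rw [map_smul, ← hw g, LinearMap.smul_apply, smul_smul, mul_inv_cancel₀ hne, one_smul]
  rfl

/-- A functional on `Z*` controlled by `‖T* g‖` up to a multiple of `‖b‖ ‖g‖` lies within a multiple of
`‖b‖` of an element of `Z`: extend it to `Z* × Z*` along `g ↦ (a T* g, b g)`; the first component of
the extension is a value of `T**`, the second one is small. -/
theorem IsWeaklyCompactOperator.exists_norm_sub_le {T : Z →L[𝕜] Z}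
    (hT : IsWeaklyCompactOperator T) (ψ : StrongDual 𝕜 Z →ₗ[𝕜] 𝕜) {a b : 𝕜} {C : ℝ}
    (hb : b ≠ 0) (hC : 0 ≤ C)
    (hψ : ∀ g : StrongDual 𝕜 Z, ‖ψ g‖ ≤ C * max (‖a‖ * ‖g.comp T‖) (‖b‖ * ‖g‖)) :
    ∃ w : Z, ∀ g : StrongDual 𝕜 Z, ‖ψ g - g w‖ ≤ C * ‖b‖ * ‖g‖ := by
  let J : StrongDual 𝕜 Z →ₗ[𝕜] StrongDual 𝕜 Z × StrongDual 𝕜 Z :=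
    ((a • ContinuousLinearMap.precomp 𝕜 T).prod
      (b • ContinuousLinearMap.id 𝕜 (StrongDual 𝕜 Z))).toLinearMap
  have hJ : Function.Injective J := fun g g' h => by
    have := congrArg Prod.snd h
    simpa [J, hb] using this
  have hJnorm : ∀ g, ‖J g‖ = max (‖a‖ * ‖g.comp T‖) (‖b‖ * ‖g‖) := fun g => by
    simp [J, Prod.norm_def, norm_smul]
  let e := LinearEquiv.ofInjective J hJ
  obtain ⟨Φ, hΦ, hΦnorm⟩ := exists_extension_norm_eq J.range
    (LinearMap.mkContinuous (ψ.comp e.symm.toLinearMap) C (fun y => by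
      obtain ⟨g, rfl⟩ := e.surjective y
      have : ‖e g‖ = ‖J g‖ := rfl
      simpa [this, hJnorm] using hψ g))
  have hΦC : ‖Φ‖ ≤ C := hΦnorm.trans_le (LinearMap.mkContinuous_norm_le _ hC _)
  have hΦJ : ∀ g, Φ (J g) = ψ g := fun g => by
    have := hΦ (e g)
    simpa [e] using this
  obtain ⟨w, hw⟩ := hT.exists_bidual_eq (Φ.comp (ContinuousLinearMap.inl 𝕜 _ _))
  refine ⟨a • w, fun g => ?_⟩
  have key : ψ g - g (a • w) = Φ (0, b • g) := by
    have h1 : J g = a • ContinuousLinearMap.inl 𝕜 (StrongDual 𝕜 Z) (StrongDual 𝕜 Z) (g.comp T)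
        + (0, b • g) := by
      ext <;> simp [J]
    have h2 := hw g
    rw [ContinuousLinearMap.comp_apply] at h2
    rw [← hΦJ, h1, map_add, map_smul, map_smul, h2, add_sub_cancel_left]
  rw [key]
  refine (Φ.le_of_opNorm_le hΦC _).trans_eq ?_
  simp [Prod.norm_def, norm_smul, mul_nonneg, mul_assoc]

/-- A functional on `Z*` that is dominated by `2 ^ n ‖T* g‖` and `2⁻¹ ^ n ‖g‖` for every `n` is the
evaluation at a point of `Z`, since it is a norm limit of such evaluations. -/
theorem IsWeaklyCompactOperator.exists_forall_apply_eq [CompleteSpace Z] {T : Z →L[𝕜] Z}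
    (hT : IsWeaklyCompactOperator T) (ψ : StrongDual 𝕜 Z →ₗ[𝕜] 𝕜) {C : ℝ} (hC : 0 ≤ C)
    (hψ : ∀ (n : ℕ) (g : StrongDual 𝕜 Z),
      ‖ψ g‖ ≤ C * max (2 ^ n * ‖g.comp T‖) (2⁻¹ ^ n * ‖g‖)) :
    ∃ w : Z, ∀ g : StrongDual 𝕜 Z, ψ g = g w := by
  choose w hw using fun n : ℕ => hT.exists_norm_sub_le ψ
    (a := 2 ^ n) (b := 2⁻¹ ^ n) (pow_ne_zero _ (inv_ne_zero two_ne_zero)) hC (by simpa using hψ n)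
  simp only [norm_pow, norm_inv, RCLike.norm_two] at hw
  have hlim : Tendsto (fun n : ℕ => C * (2⁻¹ : ℝ) ^ n) atTop (𝓝 0) := by
    simpa using (tendsto_pow_atTop_nhds_zero_of_lt_one (r := (2⁻¹ : ℝ))
      (by norm_num) (by norm_num)).const_mul C
  have hcauchy : CauchySeq w := by
    refine cauchySeq_of_le_tendsto_0 (fun n => C * 2⁻¹ ^ n + C * 2⁻¹ ^ n) (fun m k n hm hk => ?_)
      (by simpa using hlim.add hlim)
    have hanti : ∀ j, n ≤ j → C * (2⁻¹ : ℝ) ^ j ≤ C * 2⁻¹ ^ n := fun j hj =>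
      mul_le_mul_of_nonneg_left (pow_le_pow_of_le_one (by norm_num) (by norm_num) hj) hC
    rw [dist_eq_norm]
    refine NormedSpace.norm_le_dual_bound 𝕜 _ (by positivity) fun g => ?_
    calc ‖g (w m - w k)‖ = ‖(ψ g - g (w k)) - (ψ g - g (w m))‖ := by rw [map_sub]; congr 1; ring
      _ ≤ C * 2⁻¹ ^ k * ‖g‖ + C * 2⁻¹ ^ m * ‖g‖ :=
        (norm_sub_le _ _).trans (add_le_add (hw k g) (hw m g))
      _ ≤ C * 2⁻¹ ^ n * ‖g‖ + C * 2⁻¹ ^ n * ‖g‖ := by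
        have h1 := hanti m hm
        have h2 := hanti k hk
        gcongr ?_ * _ + ?_ * _
      _ = _ := by ring
  obtain ⟨z, hz⟩ := cauchySeq_tendsto_of_complete hcauchy
  refine ⟨z, fun g => ?_⟩
  have h1 : Tendsto (fun n => g (w n)) atTop (𝓝 (g z)) := (g.continuous.tendsto z).comp hz
  have h2 : Tendsto (fun n => g (w n)) atTop (𝓝 (ψ g)) := by
    rw [tendsto_iff_norm_sub_tendsto_zero]
    refine squeeze_zero (fun _ => norm_nonneg _)
      (fun n => (norm_sub_rev _ _).trans_le (hw n g)) ?_
    simpa using hlim.mul_const ‖g‖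
  exact tendsto_nhds_unique h2 h1

end

/-! ### Functionals on `ℓ²` sums and reflexivity of their closed subspaces -/

section

open Filter Topology

variable {𝕜 ι : Type*} [RCLike 𝕜] {E : ι → Type*} [∀ i, NormedAddCommGroup (E i)]

theorem le_sq_of_le_mul_sqrt {S M : ℝ} (hS : 0 ≤ S) (h : S ≤ M * √S) : S ≤ M ^ 2 := by
  rcases hS.eq_or_lt with rfl | hpos
  · positivity
  have h1 : √S ≤ M := by
    have h2 : 0 < √S := Real.sqrt_pos.2 hpos
    refine le_of_mul_le_mul_right ?_ h2
    rwa [Real.mul_self_sqrt hS]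
  calc S = √S ^ 2 := (Real.sq_sqrt hS).symm
    _ ≤ M ^ 2 := by gcongr

theorem lp.sqrt_sum_norm_sq_le (x : lp E 2) (s : Finset ι) : √(∑ i ∈ s, ‖x i‖ ^ 2) ≤ ‖x‖ := by
  have := lp.sum_rpow_le_norm_rpow (p := 2) (by norm_num) x s
  refine Real.sqrt_le_iff.2 ⟨norm_nonneg _, ?_⟩
  simpa using this

/-- Cauchy–Schwarz for a finite sum of functions of the coordinates. -/
theorem lp.norm_sum_apply_le {s : Finset ι} {c : ι → ℝ} {f : ∀ i, E i → 𝕜} (x : lp E 2)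
    (hf : ∀ i ∈ s, ‖f i (x i)‖ ≤ c i * ‖x i‖) :
    ‖∑ i ∈ s, f i (x i)‖ ≤ √(∑ i ∈ s, c i ^ 2) * ‖x‖ :=
  calc ‖∑ i ∈ s, f i (x i)‖ ≤ ∑ i ∈ s, c i * ‖x i‖ := norm_sum_le_of_le s hf
    _ ≤ √(∑ i ∈ s, c i ^ 2) * √(∑ i ∈ s, ‖x i‖ ^ 2) := Real.sum_mul_le_sqrt_mul_sqrt _ _ _
    _ ≤ √(∑ i ∈ s, c i ^ 2) * ‖x‖ := by gcongr; exact lp.sqrt_sum_norm_sq_le x s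

variable [∀ i, NormedSpace 𝕜 (E i)]

/-- A closed subspace contains every vector that is annihilated by all functionals vanishing on it. -/
theorem Submodule.mem_of_forall_dual {V : Type*} [NormedAddCommGroup V] [NormedSpace 𝕜 V]
    {X : Submodule 𝕜 V} (hX : IsClosed (X : Set V)) {v : V}
    (h : ∀ F : StrongDual 𝕜 V, (∀ x ∈ X, F x = 0) → F v = 0) : v ∈ X := by
  obtain ⟨g, -, hg⟩ := exists_dual_vector'' 𝕜 (X.mkQL v)
  have h0 := h (g.comp X.mkQL) fun x hx => by
    have : X.mkQL x = 0 := (Submodule.Quotient.mk_eq_zero X).2 hx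
    simp [this]
  rw [ContinuousLinearMap.comp_apply, hg] at h0
  refine (Submodule.Quotient.mk_eq_zero X).1 (norm_eq_zero.1 ?_)
  exact_mod_cast h0

/-- If a bounded functional `φ` on the dual of a subspace of an `ℓ²` sum acts on the coordinate
functionals as a family `ξ` does, then `ξ` is square summable: test `φ` on finite combinations of
coordinate functionals norming the `ξ i`. -/
theorem lp.memℓp_of_bidual_apply_eq {X : Submodule 𝕜 (lp E 2)}
    {φ : StrongDual 𝕜 X →ₗ[𝕜] 𝕜} {M : ℝ} (hM : 0 ≤ M)
    (hφ : ∀ f, ‖φ f‖ ≤ M * ‖f‖) {ξ : ∀ i, E i}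
    (h : ∀ (i : ι) (g : StrongDual 𝕜 (E i)),
      φ ((g.comp (lp.evalCLM 𝕜 E 2 i)).comp X.subtypeL) = g (ξ i)) : Memℓp ξ 2 := by
  refine memℓp_gen' (C := M ^ 2) fun s => ?_
  simp only [ENNReal.toReal_ofNat, Real.rpow_ofNat]
  have hS : 0 ≤ ∑ i ∈ s, ‖ξ i‖ ^ 2 := by positivity
  refine le_sq_of_le_mul_sqrt hS ?_
  choose g hg1 hg2 using fun i => exists_dual_vector'' 𝕜 (ξ i)
  let f : StrongDual 𝕜 X :=
    ∑ i ∈ s, (‖ξ i‖ : 𝕜) • (((g i).comp (lp.evalCLM 𝕜 E 2 i)).comp X.subtypeL)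
  have hφf : φ f = ((∑ i ∈ s, ‖ξ i‖ ^ 2 : ℝ) : 𝕜) := by
    simp only [f, map_sum, map_smul, h, hg2, smul_eq_mul]
    exact Finset.sum_congr rfl fun i _ => by simp [sq]
  have hf : ‖f‖ ≤ √(∑ i ∈ s, ‖ξ i‖ ^ 2) := by
    refine f.opNorm_le_bound (Real.sqrt_nonneg _) fun x => ?_
    have hfx : f x = ∑ i ∈ s, (‖ξ i‖ : 𝕜) • g i ((x : lp E 2) i) := by
      simp [f, sum_apply]
      rfl
    rw [hfx]
    refine lp.norm_sum_apply_le (f := fun i y => (‖ξ i‖ : 𝕜) • g i y) (x : lp E 2) fun i _ => ?_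
    rw [norm_smul, RCLike.norm_ofReal, abs_norm]
    gcongr
    simpa using (g i).le_of_opNorm_le (hg1 i) ((x : lp E 2) i)
  calc ∑ i ∈ s, ‖ξ i‖ ^ 2 = ‖φ f‖ := by
        rw [hφf, RCLike.norm_ofReal, abs_of_nonneg hS]
    _ ≤ M * ‖f‖ := hφ f
    _ ≤ _ := by gcongr

variable [DecidableEq ι]

/-- The coordinates of a continuous functional on an `ℓ²` sum are square summable in norm. -/
theorem lp.summable_norm_comp_single_sq (F : StrongDual 𝕜 (lp E 2)) :
    Summable fun i => ‖F.comp (lp.singleContinuousLinearMap 𝕜 E 2 i)‖ ^ 2 := by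
  have hy : ∀ i, ∃ y : E i, ‖y‖ ≤ 1 ∧
      ‖F.comp (lp.singleContinuousLinearMap 𝕜 E 2 i)‖ ≤ 2 * ‖F (lp.single 2 i y)‖ := fun i => by
    rcases (norm_nonneg (F.comp (lp.singleContinuousLinearMap 𝕜 E 2 i))).eq_or_lt with h | h
    · exact ⟨0, by simp, by rw [← h]; positivity⟩
    · obtain ⟨y, hy, hlt⟩ := ContinuousLinearMap.exists_lt_apply_of_lt_opNorm
        (F.comp (lp.singleContinuousLinearMap 𝕜 E 2 i)) (half_lt_self h)
      refine ⟨y, hy.le, ?_⟩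
      have : ‖F (lp.single 2 i y)‖ = ‖(F.comp (lp.singleContinuousLinearMap 𝕜 E 2 i)) y‖ := rfl
      rw [this]; linarith
  choose y hy1 hy2 using hy
  -- Testing `F` on `∑ conj (d i) • y i` over a finite set bounds the sum of the `‖d i‖ ^ 2`.
  let d : ι → 𝕜 := fun i => F (lp.single 2 i (y i))
  have hd : ∀ s : Finset ι, ∑ i ∈ s, ‖d i‖ ^ 2 ≤ ‖F‖ ^ 2 := fun s => by
    have hS : 0 ≤ ∑ i ∈ s, ‖d i‖ ^ 2 := by positivity
    refine le_sq_of_le_mul_sqrt hS ?_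
    let x : lp E 2 := ∑ i ∈ s, lp.single 2 i ((starRingEnd 𝕜) (d i) • y i)
    have hFx : F x = ((∑ i ∈ s, ‖d i‖ ^ 2 : ℝ) : 𝕜) := by
      simp only [x, map_sum, RCLike.ofReal_pow]
      refine Finset.sum_congr rfl fun i _ => ?_
      rw [lp.single_smul, map_smul, smul_eq_mul, RCLike.conj_mul]
    have hx : ‖x‖ ≤ √(∑ i ∈ s, ‖d i‖ ^ 2) := by
      refine Real.le_sqrt_of_sq_le ?_
      have := lp.norm_sum_single (p := 2) (by norm_num) (fun i => (starRingEnd 𝕜) (d i) • y i) s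
      simp only [ENNReal.toReal_ofNat, Real.rpow_ofNat] at this
      rw [this]
      refine Finset.sum_le_sum fun i _ => ?_
      rw [norm_smul, RCLike.norm_conj]
      gcongr
      exact mul_le_of_le_one_right (norm_nonneg _) (hy1 i)
    calc ∑ i ∈ s, ‖d i‖ ^ 2 = ‖F x‖ := by
          rw [hFx, RCLike.norm_ofReal, abs_of_nonneg hS]
      _ ≤ ‖F‖ * ‖x‖ := F.le_opNorm x
      _ ≤ _ := by gcongr
  refine Summable.of_nonneg_of_le (fun _ => by positivity) (fun i => ?_)
    ((summable_of_sum_le (fun i => by positivity) hd).mul_left 4)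
  calc _ ≤ (2 * ‖d i‖) ^ 2 := by gcongr; exact hy2 i
    _ = 4 * ‖d i‖ ^ 2 := by ring

/-- A continuous functional on an `ℓ²` sum is a norm limit of functionals depending on finitely many
coordinates. -/
theorem lp.exists_norm_apply_sub_sum_le (F : StrongDual 𝕜 (lp E 2)) {ε : ℝ} (hε : 0 < ε) :
    ∃ s : Finset ι, ∀ x : lp E 2, ‖F x - ∑ i ∈ s, F (lp.single 2 i (x i))‖ ≤ ε * ‖x‖ := by
  obtain ⟨s, hs⟩ := summable_iff_vanishing_norm.1 (lp.summable_norm_comp_single_sq F) (ε ^ 2)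
    (by positivity)
  refine ⟨s, fun x => ?_⟩
  have hsum : HasSum (fun i => F (lp.single 2 i (x i))) (F x) :=
    (lp.hasSum_single (by norm_num) x).mapL F
  refine le_of_tendsto (hsum.sub_const _).norm ?_
  filter_upwards [eventually_ge_atTop s] with t hst
  rw [← Finset.sum_sdiff hst, add_sub_cancel_right]
  refine (lp.norm_sum_apply_le (f := fun i y => F (lp.single 2 i y)) x fun i _ =>
    (F.comp (lp.singleContinuousLinearMap 𝕜 E 2 i)).le_opNorm (x i)).trans ?_
  gcongr
  refine Real.sqrt_le_iff.2 ⟨hε.le, ?_⟩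
  exact (le_abs_self _).trans (hs _ Finset.sdiff_disjoint).le

/-- Agreement with `ξ` on the functionals of one coordinate passes to all functionals, by norm
approximation. -/
theorem lp.bidual_apply_comp_subtypeL {X : Submodule 𝕜 (lp E 2)}
    {φ : StrongDual 𝕜 X →ₗ[𝕜] 𝕜} {M : ℝ} (hM : 0 ≤ M)
    (hφ : ∀ f, ‖φ f‖ ≤ M * ‖f‖) (ξ : lp E 2)
    (h : ∀ (i : ι) (g : StrongDual 𝕜 (E i)),
      φ ((g.comp (lp.evalCLM 𝕜 E 2 i)).comp X.subtypeL) = g (ξ i)) (F : StrongDual 𝕜 (lp E 2)) :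
    φ (F.comp X.subtypeL) = F ξ := by
  rw [← sub_eq_zero, ← norm_le_zero_iff]
  refine le_of_forall_pos_le_add fun δ hδ => ?_
  obtain ⟨s, hs⟩ := lp.exists_norm_apply_sub_sum_le F (ε := δ / (M + ‖ξ‖ + 1)) (by positivity)
  set ε := δ / (M + ‖ξ‖ + 1) with hε
  let G : StrongDual 𝕜 (lp E 2) :=
    ∑ i ∈ s, (F.comp (lp.singleContinuousLinearMap 𝕜 E 2 i)).comp (lp.evalCLM 𝕜 E 2 i)
  have hG : ∀ x, G x = ∑ i ∈ s, F (lp.single 2 i (x i)) := fun x => by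
    simp [G, sum_apply]
    rfl
  have hφG : φ (G.comp X.subtypeL) = G ξ := by
    have : G.comp X.subtypeL = ∑ i ∈ s, ((F.comp (lp.singleContinuousLinearMap 𝕜 E 2 i)).comp
        (lp.evalCLM 𝕜 E 2 i)).comp X.subtypeL := by
      ext x; simp [G, sum_apply]
    rw [this, map_sum, hG]
    exact Finset.sum_congr rfl fun i _ => h i _
  have hFG : ‖(F - G).comp X.subtypeL‖ ≤ ε :=
    ContinuousLinearMap.opNorm_le_bound _ (by positivity) fun x => by
      simpa [hG] using hs (x : lp E 2)
  calc ‖φ (F.comp X.subtypeL) - F ξ‖ = ‖φ ((F - G).comp X.subtypeL) - (F ξ - G ξ)‖ := by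
        rw [ContinuousLinearMap.sub_comp, map_sub, hφG]; congr 1; ring
    _ ≤ M * ε + ε * ‖ξ‖ := by
        refine (norm_sub_le _ _).trans (add_le_add ((hφ _).trans (by gcongr)) ?_)
        rw [hG]; exact hs ξ
    _ ≤ ε * (M + ‖ξ‖ + 1) := by
        have : 0 ≤ ε := by positivity
        nlinarith
    _ = 0 + δ := by rw [hε, zero_add]; field_simp

/-- A bounded functional on the dual of a closed subspace of an `ℓ²` sum is an evaluation as soon as it
acts as an evaluation on the functionals that depend on one coordinate. -/
theorem lp.exists_forall_apply_eq {X : Submodule 𝕜 (lp E 2)}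
    (hX : IsClosed (X : Set (lp E 2))) {φ : StrongDual 𝕜 X →ₗ[𝕜] 𝕜} {M : ℝ} (hM : 0 ≤ M)
    (hφ : ∀ f, ‖φ f‖ ≤ M * ‖f‖) {ξ : ∀ i, E i}
    (h : ∀ (i : ι) (g : StrongDual 𝕜 (E i)),
      φ ((g.comp (lp.evalCLM 𝕜 E 2 i)).comp X.subtypeL) = g (ξ i)) :
    ∃ x, ∀ f, φ f = f x := by
  let η : lp E 2 := ⟨ξ, lp.memℓp_of_bidual_apply_eq hM hφ h⟩
  have hη := lp.bidual_apply_comp_subtypeL hM hφ η h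
  have hmem : η ∈ X := Submodule.mem_of_forall_dual (𝕜 := 𝕜) hX fun F hF => by
    have : F.comp X.subtypeL = 0 := by ext x; exact hF x x.2
    rw [← hη F, this, map_zero]
  refine ⟨⟨η, hmem⟩, fun f => ?_⟩
  obtain ⟨F, hF, -⟩ := exists_extension_norm_eq X f
  have : f = F.comp X.subtypeL := by ext x; exact (hF x).symm
  rw [this, hη]; rfl

/-- Reflexivity expressed with algebraic functionals on the dual and an explicit bound. -/
theorem isReflexiveSpace_of_forall_linearMap {V : Type*} [NormedAddCommGroup V] [NormedSpace 𝕜 V]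
    (h : ∀ (φ : StrongDual 𝕜 V →ₗ[𝕜] 𝕜) (M : ℝ), 0 ≤ M → (∀ f, ‖φ f‖ ≤ M * ‖f‖) →
      ∃ x, ∀ f, φ f = f x) : IsReflexiveSpace 𝕜 V := fun φ => by
  obtain ⟨x, hx⟩ := h φ.toLinearMap ‖φ‖ (norm_nonneg φ) φ.le_opNorm
  exact ⟨x, ContinuousLinearMap.ext fun f => (hx f).symm⟩

end

/-! ### The Davis–Figiel–Johnson–Pełczyński factorization -/

section

variable {𝕜 : Type v} {Z : Type u} [RCLike 𝕜] [NormedAddCommGroup Z] [NormedSpace 𝕜 Z]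

namespace DFJP

/-- The map `(u, v) ↦ 2 ^ n T u + 2⁻¹ ^ n v`. The image of the unit ball is the set
`2 ^ n T (ball) + 2⁻¹ ^ n ball` of the classical construction. -/
noncomputable def stageMap (T : Z →L[𝕜] Z) (n : ℕ) : Z × Z →L[𝕜] Z :=
  ((2 : 𝕜) ^ n • T).coprod ((2⁻¹ : 𝕜) ^ n • ContinuousLinearMap.id 𝕜 Z)

theorem stageMap_apply (T : Z →L[𝕜] Z) (n : ℕ) (p : Z × Z) :
    stageMap T n p = (2 : 𝕜) ^ n • T p.1 + (2⁻¹ : 𝕜) ^ n • p.2 := by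
  simp [stageMap]

instance isClosed_ker_stageMap (T : Z →L[𝕜] Z) (n : ℕ) :
    IsClosed ((stageMap T n).ker : Set (Z × Z)) :=
  (stageMap T n).isClosed_ker

/-- The space `Z` renormed by the gauge of `2 ^ n T (ball) + 2⁻¹ ^ n ball`, encoded as the quotient of
`Z × Z` by the kernel of `stageMap T n`, so that completeness and the norm come from the quotient. -/
abbrev Stage (T : Z →L[𝕜] Z) (n : ℕ) : Type u := (Z × Z) ⧸ (stageMap T n).ker

/-- The isomorphism from the `n`-th renorming of `Z` to `Z`. -/
noncomputable def ofStage (T : Z →L[𝕜] Z) (n : ℕ) : Stage T n →L[𝕜] Z :=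
  (stageMap T n).ker.liftQL (stageMap T n) le_rfl

/-- The inverse of `ofStage`, given by `z ↦ [(0, 2 ^ n z)]`. -/
noncomputable def toStage (T : Z →L[𝕜] Z) (n : ℕ) : Z →L[𝕜] Stage T n :=
  (stageMap T n).ker.mkQL.comp
    ((2 : 𝕜) ^ n • ContinuousLinearMap.inr 𝕜 Z Z)

/-- The operator `T` with values in the `n`-th renorming of `Z`. It is given by `z ↦ [(2⁻¹ ^ n z, 0)]`,
which makes its norm at most `2⁻¹ ^ n`. -/
noncomputable def stageFactor (T : Z →L[𝕜] Z) (n : ℕ) : Z →L[𝕜] Stage T n :=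
  (stageMap T n).ker.mkQL.comp
    ((2⁻¹ : 𝕜) ^ n • ContinuousLinearMap.inl 𝕜 Z Z)

variable (T : Z →L[𝕜] Z)

theorem ofStage_mk (n : ℕ) (p : Z × Z) :
    ofStage T n (Submodule.Quotient.mk p) = stageMap T n p := rfl

theorem ofStage_injective (n : ℕ) : Function.Injective (ofStage T n) := by
  refine (injective_iff_map_eq_zero _).2 fun q hq => ?_
  obtain ⟨p, rfl⟩ := Submodule.Quotient.mk_surjective _ q
  exact (Submodule.Quotient.mk_eq_zero _).2 hq

theorem ofStage_toStage (n : ℕ) (z : Z) : ofStage T n (toStage T n z) = z := by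
  change stageMap T n ((2 : 𝕜) ^ n • (0, z)) = z
  simp [stageMap_apply, smul_smul]

theorem toStage_ofStage (n : ℕ) (q : Stage T n) : toStage T n (ofStage T n q) = q :=
  ofStage_injective T n (ofStage_toStage T n _)

theorem ofStage_stageFactor (n : ℕ) (z : Z) : ofStage T n (stageFactor T n z) = T z := by
  change stageMap T n ((2⁻¹ : 𝕜) ^ n • (z, 0)) = T z
  simp [stageMap_apply, smul_smul]

theorem norm_stageFactor_le (n : ℕ) (z : Z) : ‖stageFactor T n z‖ ≤ 2⁻¹ ^ n * ‖z‖ := by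
  refine (Submodule.Quotient.norm_mk_le (S := (stageMap T n).ker)
    ((2⁻¹ : 𝕜) ^ n • (z, (0 : Z)))).trans_eq ?_
  rw [norm_smul, norm_pow, norm_inv, RCLike.norm_two, Prod.norm_mk]
  simp

/-- In the dual norm of the `n`-th renorming, a functional `g` on `Z` is controlled by
`2 ^ n ‖T* g‖` and `2⁻¹ ^ n ‖g‖`. -/
theorem norm_apply_ofStage_le (n : ℕ) (g : StrongDual 𝕜 Z) (q : Stage T n) :
    ‖g (ofStage T n q)‖ ≤ 2 * max (2 ^ n * ‖g.comp T‖) (2⁻¹ ^ n * ‖g‖) * ‖q‖ := by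
  set K := max (2 ^ n * ‖g.comp T‖) (2⁻¹ ^ n * ‖g‖)
  have hK : 0 ≤ K := le_max_of_le_left (by positivity)
  refine le_of_forall_pos_le_add fun ε hε => ?_
  obtain ⟨p, rfl, hp⟩ := Submodule.Quotient.norm_mk_lt q (ε := ε / (2 * K + 1)) (by positivity)
  rw [ofStage_mk, stageMap_apply, map_add, map_smul, map_smul]
  have h1 : ‖(2 : 𝕜) ^ n • g (T p.1)‖ ≤ K * ‖p‖ := by
    rw [norm_smul, norm_pow, RCLike.norm_two]
    calc 2 ^ n * ‖g (T p.1)‖ ≤ 2 ^ n * (‖g.comp T‖ * ‖p.1‖) := by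
          gcongr; exact (g.comp T).le_opNorm p.1
      _ = (2 ^ n * ‖g.comp T‖) * ‖p.1‖ := by ring
      _ ≤ K * ‖p‖ := mul_le_mul (le_max_left _ _) (norm_fst_le p) (norm_nonneg _) hK
  have h2 : ‖(2⁻¹ : 𝕜) ^ n • g p.2‖ ≤ K * ‖p‖ := by
    rw [norm_smul, norm_pow, norm_inv, RCLike.norm_two]
    calc 2⁻¹ ^ n * ‖g p.2‖ ≤ 2⁻¹ ^ n * (‖g‖ * ‖p.2‖) := by
          gcongr; exact g.le_opNorm p.2
      _ = (2⁻¹ ^ n * ‖g‖) * ‖p.2‖ := by ring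
      _ ≤ K * ‖p‖ := mul_le_mul (le_max_right _ _) (norm_snd_le p) (norm_nonneg _) hK
  calc _ ≤ K * ‖p‖ + K * ‖p‖ := norm_add_le_of_le h1 h2
    _ = 2 * K * ‖p‖ := by ring
    _ ≤ 2 * K * (‖(Submodule.Quotient.mk p : Stage T n)‖ + ε / (2 * K + 1)) := by gcongr
    _ = 2 * K * ‖(Submodule.Quotient.mk p : Stage T n)‖ + ε * (2 * K / (2 * K + 1)) := by ring
    _ ≤ _ := by
      gcongr
      refine mul_le_of_le_one_right hε.le ((div_le_one (by positivity)).2 (by linarith))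

theorem sum_norm_stageFactor_sq_le (z : Z) (s : Finset ℕ) :
    ∑ n ∈ s, ‖stageFactor T n z‖ ^ 2 ≤ (2 * ‖z‖) ^ 2 := by
  have hgeom : ∑ n ∈ s, (4⁻¹ : ℝ) ^ n ≤ 4 := by
    refine (Summable.sum_le_tsum s (fun _ _ => by positivity)
      (summable_geometric_of_lt_one (by norm_num) (by norm_num))).trans ?_
    rw [tsum_geometric_of_lt_one (by norm_num) (by norm_num)]
    norm_num
  calc ∑ n ∈ s, ‖stageFactor T n z‖ ^ 2 ≤ ∑ n ∈ s, (4⁻¹ : ℝ) ^ n * ‖z‖ ^ 2 := by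
        refine Finset.sum_le_sum fun n _ => ?_
        calc ‖stageFactor T n z‖ ^ 2 ≤ (2⁻¹ ^ n * ‖z‖) ^ 2 := by
              gcongr; exact norm_stageFactor_le T n z
          _ = (4⁻¹ : ℝ) ^ n * ‖z‖ ^ 2 := by
            rw [mul_pow, ← pow_mul, mul_comm n, pow_mul]; norm_num
    _ = (∑ n ∈ s, (4⁻¹ : ℝ) ^ n) * ‖z‖ ^ 2 := by rw [Finset.sum_mul]
    _ ≤ 4 * ‖z‖ ^ 2 := by gcongr
    _ = _ := by ring

/-- The operator `T` with values in the `ℓ²` sum of all renormings of `Z`, as a constant sequence. -/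
noncomputable def diagonal : Z →L[𝕜] lp (Stage T) 2 :=
  LinearMap.mkContinuous
    { toFun := fun z => ⟨fun n => stageFactor T n z, memℓp_gen' (C := (2 * ‖z‖) ^ 2) fun s => by
        simpa using sum_norm_stageFactor_sq_le T z s⟩
      map_add' := fun x y => by ext n; exact map_add (stageFactor T n) x y
      map_smul' := fun c x => by ext n; exact map_smul (stageFactor T n) c x } 2 fun z =>
    lp.norm_le_of_forall_sum_le (by norm_num) (by positivity) fun s => by
      simpa using sum_norm_stageFactor_sq_le T z s

/-- The intermediate space: the closure, in the `ℓ²` sum of the renormings of `Z`, of the constant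
sequences with value in the range of `T`. All its elements are constant sequences. -/
noncomputable def space : Submodule 𝕜 (lp (Stage T) 2) :=
  (diagonal T).range.topologicalClosure

theorem isClosed_space : IsClosed (space T : Set (lp (Stage T) 2)) :=
  Submodule.isClosed_topologicalClosure _

/-- The first factor of `T`, with dense range. -/
noncomputable def toSpace : Z →L[𝕜] space T :=
  (diagonal T).codRestrict (space T) fun z => subset_closure ⟨z, rfl⟩

/-- The second factor of `T`, injective: the common value of a constant sequence, read off at stage
`0`. -/
noncomputable def ofSpace : space T →L[𝕜] Z :=
  ((ofStage T 0).comp (lp.evalCLM 𝕜 (Stage T) 2 0)).comp (space T).subtypeL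

theorem denseRange_toSpace : DenseRange (toSpace T) := by
  intro x
  refine closure_subtype.2 ?_
  have : ((↑) : space T → lp (Stage T) 2) '' Set.range (toSpace T) = Set.range (diagonal T) := by
    rw [← Set.range_comp]; rfl
  rw [this]
  exact x.2

theorem ofSpace_comp_toSpace : (ofSpace T).comp (toSpace T) = T := by
  ext z
  exact ofStage_stageFactor T 0 z

theorem ofStage_apply_eq_ofSpace (x : space T) (n : ℕ) :
    ofStage T n ((x : lp (Stage T) 2) n) = ofSpace T x := by
  have : ((ofStage T n).comp (lp.evalCLM 𝕜 (Stage T) 2 n)).comp (space T).subtypeL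
      = ofSpace T := by
    refine DFunLike.coe_injective ((denseRange_toSpace T).equalizer (by fun_prop) (by fun_prop) ?_)
    funext z
    exact (ofStage_stageFactor T n z).trans (ofStage_stageFactor T 0 z).symm
  exact DFunLike.congr_fun this x

theorem ofSpace_injective : Function.Injective (ofSpace T) := fun x y h => by
  ext n
  apply ofStage_injective T n
  rw [ofStage_apply_eq_ofSpace, ofStage_apply_eq_ofSpace, h]

theorem norm_comp_ofSpace_le (g : StrongDual 𝕜 Z) (n : ℕ) :
    ‖g.comp (ofSpace T)‖ ≤ 2 * max (2 ^ n * ‖g.comp T‖) (2⁻¹ ^ n * ‖g‖) := by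
  have hK : 0 ≤ max (2 ^ n * ‖g.comp T‖) (2⁻¹ ^ n * ‖g‖) := le_max_of_le_left (by positivity)
  refine ContinuousLinearMap.opNorm_le_bound _ (by positivity) fun x => ?_
  rw [ContinuousLinearMap.comp_apply, ← ofStage_apply_eq_ofSpace T x n]
  refine (norm_apply_ofStage_le T n g _).trans ?_
  gcongr
  exact lp.norm_apply_le_norm (by norm_num) (x : lp (Stage T) 2) n

/-- The intermediate space is reflexive. A bounded functional `φ` on its dual restricts to a functional
on `Z*` which, by the stage-wise bounds, is the evaluation at some `w : Z`; the constant sequence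
`w` then represents `φ` on each coordinate. -/
theorem isReflexiveSpace_space [CompleteSpace Z] {T : Z →L[𝕜] Z}
    (hT : IsWeaklyCompactOperator T) : IsReflexiveSpace 𝕜 (space T) := by
  refine isReflexiveSpace_of_forall_linearMap fun φ M hM hφ => ?_
  obtain ⟨w, hw⟩ := hT.exists_forall_apply_eq
    (φ.comp (ContinuousLinearMap.precomp 𝕜 (ofSpace T)).toLinearMap) (C := M * 2) (by positivity)
    fun n g => by
      rw [mul_assoc]
      exact (hφ _).trans (mul_le_mul_of_nonneg_left (norm_comp_ofSpace_le T g n) hM)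
  refine lp.exists_forall_apply_eq (X := space T) (isClosed_space T) hM hφ
    (ξ := fun n => toStage T n w) fun n g => ?_
  have : (g.comp (lp.evalCLM 𝕜 (Stage T) 2 n)).comp (space T).subtypeL =
      (g.comp (toStage T n)).comp (ofSpace T) := by
    ext x
    change g ((x : lp (Stage T) 2) n) = g (toStage T n (ofSpace T x))
    rw [← ofStage_apply_eq_ofSpace T x n, toStage_ofStage]
  rw [this]
  exact hw (g.comp (toStage T n))

end DFJP

/-! ### Transfer of invariant subspaces and subsets -/

/-- If `M` is invariant under `A B`, then the closure of `B M` is invariant under `B A`, and `A` maps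
it into `M`, so that it is proper because `A` has dense range. -/
theorem hasNontrivialInvariantClosedSubspace_comp {X : Type*} [NormedAddCommGroup X]
    [NormedSpace 𝕜 X] {A : Z →L[𝕜] X} {B : X →L[𝕜] Z} (hA : DenseRange A)
    (hB : Function.Injective B) (h : HasNontrivialInvariantClosedSubspace (A.comp B)) :
    HasNontrivialInvariantClosedSubspace (B.comp A) := by
  obtain ⟨M, hM, hbot, htop, hinv⟩ := h
  have hmaps : ∀ z ∈ (M.map B.toLinearMap).topologicalClosure, A z ∈ M := fun z hz => by
    refine closure_minimal ?_ (hM.preimage A.continuous) hz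
    rintro _ ⟨m, hm, rfl⟩
    exact hinv m hm
  refine ⟨(M.map B.toLinearMap).topologicalClosure, Submodule.isClosed_topologicalClosure _,
    fun h0 => hbot ?_, fun h1 => htop ?_, fun z hz => subset_closure ⟨A z, hmaps z hz, rfl⟩⟩
  · refine (Submodule.eq_bot_iff M).2 fun m hm => hB ?_
    have : B m ∈ (M.map B.toLinearMap).topologicalClosure := subset_closure ⟨m, hm, rfl⟩
    rw [h0, Submodule.mem_bot] at this
    rw [this, map_zero]
  · refine Submodule.eq_top_iff'.2 fun x => ?_
    refine closure_minimal ?_ hM (hA x)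
    rintro _ ⟨z, rfl⟩
    exact hmaps z (h1 ▸ Submodule.mem_top)

theorem hasNontrivialInvariantClosedSubset_comp {X : Type*} [NormedAddCommGroup X]
    [NormedSpace 𝕜 X] {A : Z →L[𝕜] X} {B : X →L[𝕜] Z} (hA : DenseRange A)
    (hB : Function.Injective B) (h : HasNontrivialInvariantClosedSubset (A.comp B)) :
    HasNontrivialInvariantClosedSubset (B.comp A) := by
  obtain ⟨M, hM, hne, hbot, htop, hinv⟩ := h
  have hmaps : ∀ z ∈ closure (B '' M), A z ∈ M := fun z hz => by
    refine closure_minimal ?_ (hM.preimage A.continuous) hz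
    rintro _ ⟨m, hm, rfl⟩
    exact hinv m hm
  refine ⟨closure (B '' M), isClosed_closure, (hne.image B).closure,
    fun h0 => hbot ?_, fun h1 => htop ?_, fun z hz => subset_closure ⟨A z, hmaps z hz, rfl⟩⟩
  · refine hne.subset_singleton_iff.1 fun m hm => hB ?_
    have : B m ∈ closure (B '' M) := subset_closure ⟨m, hm, rfl⟩
    rw [h0, Set.mem_singleton_iff] at this
    rw [this, map_zero]
  · refine Set.eq_univ_of_forall fun x => ?_
    refine closure_minimal ?_ hM (hA x)
    rintro _ ⟨z, rfl⟩
    exact hmaps z (h1 ▸ Set.mem_univ z)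

theorem HasNontrivialInvariantClosedSubspace.subset {T : Z →L[𝕜] Z}
    (h : HasNontrivialInvariantClosedSubspace T) : HasNontrivialInvariantClosedSubset T := by
  obtain ⟨M, hM, hbot, htop, hinv⟩ := h
  refine ⟨M, hM, M.nonempty, fun h0 => hbot ?_, fun h1 => htop ?_, hinv⟩
  · exact SetLike.coe_injective (h0.trans Submodule.bot_coe.symm)
  · exact SetLike.coe_injective (h1.trans Submodule.top_coe.symm)

/-- On an infinite-dimensional space an operator that factors through a finite-dimensional one has an
invariant subspace: the kernel of the first factor, or any line if this factor vanishes. -/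
theorem hasNontrivialInvariantClosedSubspace_of_finiteDimensional {X : Type*}
    [NormedAddCommGroup X] [NormedSpace 𝕜 X] [FiniteDimensional 𝕜 X] (A : Z →L[𝕜] X)
    (B : X →L[𝕜] Z) (hZ : ¬ FiniteDimensional 𝕜 Z) :
    HasNontrivialInvariantClosedSubspace (B.comp A) := by
  by_cases hA : A.ker = ⊤
  · have hzero : ∀ z, A z = 0 := fun z => by
      have : z ∈ A.ker := hA ▸ Submodule.mem_top
      exact this
    have : Nontrivial Z := by
      by_contra hn
      rw [not_nontrivial_iff_subsingleton] at hn
      exact hZ inferInstance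
    obtain ⟨z, hz⟩ := exists_ne (0 : Z)
    refine ⟨𝕜 ∙ z, Submodule.closed_of_finiteDimensional _, by simpa using hz, fun htop => hZ ?_,
      fun x _ => by simp [hzero]⟩
    exact Module.finite_def.2 (htop ▸ Submodule.fg_span_singleton z)
  · refine ⟨A.ker, A.isClosed_ker, fun hbot => hZ ?_, hA, fun x hx => ?_⟩
    · exact FiniteDimensional.of_injective A.toLinearMap (LinearMap.ker_eq_bot.1 hbot)
    · have : A x = 0 := hx
      simp [this]

end

theorem proposition6p1 {𝕜 : Type v} [RCLike 𝕜] {Z : Type u} [NormedAddCommGroup Z]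
    [NormedSpace 𝕜 Z] [CompleteSpace Z] [TopologicalSpace.SeparableSpace Z]
    (T : Z →L[𝕜] Z) (hT : IsWeaklyCompactOperator T) :
    (¬ HasNontrivialInvariantClosedSubspace T →
      ∃ (X : Type u) (_ : NormedAddCommGroup X) (_ : NormedSpace 𝕜 X)
        (A : Z →L[𝕜] X) (B : X →L[𝕜] Z),
        CompleteSpace X ∧ TopologicalSpace.SeparableSpace X ∧ IsReflexiveSpace 𝕜 X ∧
        (¬ FiniteDimensional 𝕜 Z → ¬ FiniteDimensional 𝕜 X) ∧
        T = B.comp A ∧ DenseRange A ∧ Function.Injective B ∧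
        ¬ HasNontrivialInvariantClosedSubspace (A.comp B)) ∧
    (¬ HasNontrivialInvariantClosedSubset T →
      ∃ (X : Type u) (_ : NormedAddCommGroup X) (_ : NormedSpace 𝕜 X)
        (A : Z →L[𝕜] X) (B : X →L[𝕜] Z),
        CompleteSpace X ∧ TopologicalSpace.SeparableSpace X ∧ IsReflexiveSpace 𝕜 X ∧
        (¬ FiniteDimensional 𝕜 Z → ¬ FiniteDimensional 𝕜 X) ∧
        T = B.comp A ∧ DenseRange A ∧ Function.Injective B ∧
        ¬ HasNontrivialInvariantClosedSubset (A.comp B)) := by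
  have hcomp := DFJP.ofSpace_comp_toSpace T
  have hdense := DFJP.denseRange_toSpace T
  have hinj := DFJP.ofSpace_injective T
  have hcomplete : CompleteSpace (DFJP.space T) := (DFJP.isClosed_space T).completeSpace_coe
  have hsep : TopologicalSpace.SeparableSpace (DFJP.space T) :=
    hdense.separableSpace (DFJP.toSpace T).continuous
  have hrefl := DFJP.isReflexiveSpace_space hT
  have hfin : ¬ HasNontrivialInvariantClosedSubspace T → ¬ FiniteDimensional 𝕜 Z →
      ¬ FiniteDimensional 𝕜 (DFJP.space T) := fun h hZ _ =>
    h (hcomp ▸ hasNontrivialInvariantClosedSubspace_of_finiteDimensional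
      (DFJP.toSpace T) (DFJP.ofSpace T) hZ)
  exact ⟨fun h => ⟨DFJP.space T, inferInstance, inferInstance, DFJP.toSpace T, DFJP.ofSpace T,
      hcomplete, hsep, hrefl, hfin h, hcomp.symm, hdense, hinj,
      fun h' => h (hcomp ▸ hasNontrivialInvariantClosedSubspace_comp hdense hinj h')⟩,
    fun h => ⟨DFJP.space T, inferInstance, inferInstance, DFJP.toSpace T, DFJP.ofSpace T,
      hcomplete, hsep, hrefl, hfin fun h' => h h'.subset, hcomp.symm, hdense, hinj,
      fun h' => h (hcomp ▸ hasNontrivialInvariantClosedSubset_comp hdense hinj h')⟩⟩
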